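/- **Setting.** Let $\mathbb{R}^{3,1}$ be $\mathbb{R}^4$ with the symmetric bilinear form $(\cdot,\cdot)$ of signature $(-+++)$, let $\mathcal{L}=\{X : (X,X)=0\}$ be its lightcone, let $\mathbb{P}(\mathcal{L})$ be the projective lightcone (the conformal $2$-sphere), and let $(x\wedge y)v=(x,v)y-(y,v)x$. A *polarised curve* $L:(\mathbb{R},q)\to\mathbb{P}(\mathcal{L})$ is a smooth regular curve $L=\langle X\rangle$ together with a smooth nowhere vanishing quadratic differential $q=q(s)\,ds^2$; it is *closed* with period $T>0$ if $L$ and $q$ are $T$-periodic. Put $$\eta = q\,\frac{X\wedge dX}{(dX,dX)},$$ which does not depend on the choice of the nowhere vanishing lift $X$ of $L$. For $\mu\in\mathbb{R}$ let $A^\mu$ be the solution of $dA^\mu=-\mu\,\eta A^\mu$, $A^\mu(0)=\mathrm{id}$. The *monodromy matrix* is $\mathcal{M}^\mu=A^\mu(T)$, and on the $\ell$-fold cover of $L$ it is $A^\mu(\ell T)$. A closed polarised curve is of *finite type* if $\mathcal{M}^\mu$ fails to be diagonalisable (over $\mathbb{C}$) for only finitely many $\mu\in\mathbb{R}$. A *resonance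 point* is a real $\mu\neq 0$ whose monodromy matrix is diagonalisable with the single eigenvalue $1$ of multiplicity $4$. For $\mathfrak{q}\in\mathbb{R}^{3,1}$ with $(\mathfrak{q},\mathfrak{q})=-\kappa$, the surface $M=\{X\in\mathcal{L} : (X,\mathfrak{q})=-1\}$ with the induced metric is a space form of sectional curvature $\kappa$. A smooth regular closed curve in $M$ is *constrained elastic* if it is a critical point of the bending energy $\int k^2\,d\sigma$ ($k$ the geodesic curvature, $\sigma$ the arc-length) under all smooth variations through regular closed curves in $M$ that fix length and enclosed area. (Enclosed area is fixed when the signed area swept out by the variation vanishes.) **Corollary 4.3.** Let $L:(\mathbb{R},q)\to\mathbb{P}(\mathcal{L})$ be a closed polarised curve of finite type with period $T$. Suppose that, for some $\kappa\in\mathbb{R}$ and some $\mathfrak{q}$ with $(\mathfrak{q},\mathfrak{q})=-\kappa$, the curve $L$ has a lift $X$ with values in $M$ that is a constrained elastic curve in $M$, and that $L$ is polarised by the arc-length of $X$ in this space form, that is, $q=(dX,dX)$. Then there are $\ell\in\mathbb{N}$, $\ell\ge 1$, and a real number $$\mu>-\frac{\kappa}{2},\qquad \mu\neq 0,$$ such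 that $\mu$ is a resonance point of $L$ on its $\ell$-fold cover. -/

import Mathlib

open scoped ContDiff

noncomputable section

namespace LightconeModel

/-! ## Minkowski space, the lightcone and the conformal 2-sphere -/

/-- The vector space underlying Minkowski space `ℝ^{3,1}`. -/
abbrev V : Type := Fin 4 → ℝ

/-- Gram matrix of the symmetric bilinear form of signature `(- + + +)`. -/
def gram : Matrix (Fin 4) (Fin 4) ℝ := Matrix.diagonal ![-1, 1, 1, 1]

/-- The symmetric bilinear form of signature `(- + + +)`. -/
def ip (x y : V) : ℝ := dotProduct (gram.mulVec x) y

theorem ip_eq (x y : V) :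
    ip x y = -(x 0 * y 0) + x 1 * y 1 + x 2 * y 2 + x 3 * y 3 := by
  simp [ip, gram, dotProduct, Fin.sum_univ_four, Matrix.mulVec_diagonal]

/-- The matrix of the skew endomorphism `x ∧ y`. -/
def wedge (x y : V) : Matrix (Fin 4) (Fin 4) ℝ :=
  Matrix.vecMulVec y (gram.mulVec x) - Matrix.vecMulVec x (gram.mulVec y)

theorem wedge_mulVec (x y v : V) :
    (wedge x y).mulVec v = ip x v • y - ip y v • x := by
  funext i
  simp only [wedge, ip, Matrix.mulVec, Matrix.vecMulVec, dotProduct, Fin.sum_univ_four,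
    Matrix.sub_apply, Matrix.of_apply, Pi.sub_apply, Pi.smul_apply, smul_eq_mul]
  ring

/-- The lightcone. -/
def lightcone : Set V := {X | ip X X = 0}

/-- The projective lightcone `ℙ(𝓛)`, that is, the conformal 2-sphere. -/
def ConformalSphere : Type :=
  {l : Projectivization ℝ V // ∀ X ∈ l.submodule, X ∈ lightcone}

/-- A smooth nowhere vanishing section of the line bundle `L` over `ℝ`. -/
structure IsLift (L : ℝ → ConformalSphere) (X : ℝ → V) : Prop where
  smooth : ContDiff ℝ ∞ X
  ne_zero : ∀ s, X s ≠ 0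
  mem : ∀ s, X s ∈ (L s).1.submodule

/-! ## Polarised curves, connections, monodromy -/

/-- A smooth regular curve `L` in the conformal 2-sphere, with domain the universal cover `ℝ`
of the parameter circle, together with a smooth non-vanishing quadratic differential
`q s ds²`. -/
structure PolarisedCurve where
  /-- the curve -/
  L : ℝ → ConformalSphere
  /-- the coefficient of the quadratic differential -/
  q : ℝ → ℝ
  regular : ∃ X, IsLift L X ∧ ∀ s, 0 < ip (deriv X s) (deriv X s)
  q_smooth : ContDiff ℝ ∞ q
  q_ne_zero : ∀ s, q s ≠ 0

namespace PolarisedCurve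

/-- The curve together with its polarisation is closed, with period `T`. -/
def IsClosedWithPeriod (Λ : PolarisedCurve) (T : ℝ) : Prop :=
  (∀ s, Λ.L (s + T) = Λ.L s) ∧ ∀ s, Λ.q (s + T) = Λ.q s

/-- `η = q (X ∧ dX) / (dX, dX)`, written in terms of a lift `X` as a matrix-valued coefficient
of `ds`. By `eta_eq` below it does not depend on the lift. -/
def eta (Λ : PolarisedCurve) (X : ℝ → V) (s : ℝ) : Matrix (Fin 4) (Fin 4) ℝ :=
  (Λ.q s / ip (deriv X s) (deriv X s)) • wedge (X s) (deriv X s)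

/-- `M` is the monodromy matrix over the period `T` with spectral parameter `μ`:
`M = A T`, where `A' = -μ η A` and `A 0 = id`. -/
def IsMonodromy (Λ : PolarisedCurve) (T μ : ℝ) (M : Matrix (Fin 4) (Fin 4) ℝ) : Prop :=
  ∃ X, IsLift Λ.L X ∧ ∃ A : ℝ → Matrix (Fin 4) (Fin 4) ℝ,
    A 0 = 1 ∧
    (∀ s i j, HasDerivAt (fun r => A r i j) ((-μ • (Λ.eta X s * A s)) i j) s) ∧
    A T = M

end PolarisedCurve

/-- Diagonalisability over the complex numbers. -/
def IsDiagonalisable (M : Matrix (Fin 4) (Fin 4) ℝ) : Prop :=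
  ∃ (P : Matrix (Fin 4) (Fin 4) ℂ) (d : Fin 4 → ℂ),
    IsUnit P ∧ M.map Complex.ofReal * P = P * Matrix.diagonal d

namespace PolarisedCurve

/-- Finite type: the monodromy matrix is diagonalisable for all but finitely many real
spectral parameters. -/
def IsFiniteType (Λ : PolarisedCurve) (T : ℝ) : Prop :=
  {μ : ℝ | ∃ M, Λ.IsMonodromy T μ M ∧ ¬ IsDiagonalisable M}.Finite

/-- `μ` is a resonance point of the curve regarded as a closed curve of period `T`: a spectral
parameter of Darboux transforms (hence non-zero; for `μ = 0` the monodromy is always trivial)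
whose monodromy matrix is diagonalisable with the single eigenvalue `1` of multiplicity `4`. -/
def IsResonancePoint (Λ : PolarisedCurve) (T μ : ℝ) : Prop :=
  μ ≠ 0 ∧ ∃ M, Λ.IsMonodromy T μ M ∧ IsDiagonalisable M ∧
    M.charpoly = (Polynomial.X - Polynomial.C 1) ^ 4

end PolarisedCurve

/-! ## Space forms and constrained elastic curves -/

/-- The space form determined by the vector `p`; with the metric induced by `ip`, it has constant
sectional curvature `-(p, p)`. -/
def spaceForm (p : V) : Set V := {X | X ∈ lightcone ∧ ip X p = -1}

/-- A smooth regular closed curve of period `T` in the space form of `p`. -/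
structure IsClosedCurveIn (p : V) (T : ℝ) (γ : ℝ → V) : Prop where
  smooth : ContDiff ℝ ∞ γ
  mem : ∀ s, γ s ∈ spaceForm p
  periodic : ∀ s, γ (s + T) = γ s
  regular : ∀ s, 0 < ip (deriv γ s) (deriv γ s)

/-- Speed of a curve. -/
def speed (γ : ℝ → V) (s : ℝ) : ℝ := Real.sqrt (ip (deriv γ s) (deriv γ s))

/-- Unit tangent field of a curve. -/
def unitTangent (γ : ℝ → V) (s : ℝ) : V := (speed γ s)⁻¹ • deriv γ s

/-- For `X` in the space form of `p`, the orthogonal projection onto the tangent space at `X`,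
which is the orthogonal complement of `X` and `p`. -/
def tangentProj (p X v : V) : V :=
  v + (ip v p + ip p p * ip v X) • X + ip v X • p

theorem tangentProj_spec (p X v : V) (hX : X ∈ spaceForm p) :
    ip (tangentProj p X v) X = 0 ∧ ip (tangentProj p X v) p = 0 ∧
      (ip v X = 0 → ip v p = 0 → tangentProj p X v = v) := by
  obtain ⟨h0, h1⟩ := hX
  have h0' : ip X X = 0 := h0
  have e1 : ∀ a b c d : V, ∀ r t : ℝ,
      ip (a + r • b + t • c) d = ip a d + r * ip b d + t * ip c d := by
    intro a b c d r t
    simp only [ip_eq, Pi.add_apply, Pi.smul_apply, smul_eq_mul]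
    ring
  have h2 : ip p X = -1 := by
    rw [← h1]
    simp only [ip_eq]
    ring
  refine ⟨?_, ?_, ?_⟩
  · rw [tangentProj, e1, h0', h2]
    ring
  · rw [tangentProj, e1, h1]
    ring
  · intro h3 h4
    simp [tangentProj, h3, h4]

/-- The curvature vector `∇_σ τ` (arc-length derivative of the unit tangent `τ`, for the
Levi-Civita connection of the space form), whose norm is the absolute geodesic curvature. -/
def curvatureVector (p : V) (γ : ℝ → V) (s : ℝ) : V :=
  tangentProj p (γ s) ((speed γ s)⁻¹ • deriv (unitTangent γ) s)

/-- Bending energy: the integral of the squared geodesic curvature over one period, with respect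
to arc-length. -/
def bendingEnergy (p : V) (T : ℝ) (γ : ℝ → V) : ℝ :=
  ∫ s in (0 : ℝ)..T, ip (curvatureVector p γ s) (curvatureVector p γ s) * speed γ s

/-- Length of one period. -/
def length (T : ℝ) (γ : ℝ → V) : ℝ := ∫ s in (0 : ℝ)..T, speed γ s

/-- The area form of the space form of `p` at `X`. -/
def areaForm (p X u v : V) : ℝ := Matrix.det ![X, p, u, v]

/-- The signed area swept out by the closed curves `Γ e`, for `e` from `0` to `ε`, which is the
difference of the signed areas enclosed by `Γ ε` and by `Γ 0`. -/
def sweptArea (p : V) (T : ℝ) (Γ : ℝ → ℝ → V) (ε : ℝ) : ℝ :=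
  ∫ e in (0 : ℝ)..ε, ∫ s in (0 : ℝ)..T,
    areaForm p (Γ e s) (deriv (fun r => Γ r s) e) (deriv (Γ e) s)

/-- A smooth variation of `γ` through regular closed curves in the space form of `p` that fixes
length and enclosed area. -/
structure IsConstrainedVariation (p : V) (T : ℝ) (γ : ℝ → V) (Γ : ℝ → ℝ → V) : Prop where
  smooth : ContDiff ℝ ∞ (fun z : ℝ × ℝ => Γ z.1 z.2)
  curve : ∀ ε, IsClosedCurveIn p T (Γ ε)
  initial : Γ 0 = γ
  length_eq : ∀ ε, length T (Γ ε) = length T γ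
  area_eq : ∀ ε, sweptArea p T Γ ε = 0

/-- A closed constrained elastic curve in the space form of `p`: a critical point of the bending
energy under variations that fix length and enclosed area. -/
def IsConstrainedElastic (p : V) (T : ℝ) (γ : ℝ → V) : Prop :=
  IsClosedCurveIn p T γ ∧
    ∀ Γ, IsConstrainedVariation p T γ Γ →
      HasDerivAt (fun ε => bendingEnergy p T (Γ ε)) 0 0

/-! ## Independence of the lift -/

theorem PolarisedCurve.eta_eq (Λ : PolarisedCurve) (X Y : ℝ → V)
    (hX : IsLift Λ.L X) (hY : IsLift Λ.L Y) (s : ℝ) : Λ.eta X s = Λ.eta Y s := by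
  have hdX : HasDerivAt X (deriv X s) s :=
    (hX.smooth.differentiable (by simp) s).hasDerivAt
  have hdY : HasDerivAt Y (deriv Y s) s :=
    (hY.smooth.differentiable (by simp) s).hasDerivAt
  have hXi : ∀ r i, ∃ a : ℝ, Y r = a • X r ∧ (X r i ≠ 0 → a = Y r i / X r i) := by
    intro r i
    obtain ⟨b, hb⟩ := Submodule.mem_span_singleton.1
      (by simpa [Projectivization.submodule_eq] using hX.mem r)
    obtain ⟨c, hc⟩ := Submodule.mem_span_singleton.1
      (by simpa [Projectivization.submodule_eq] using hY.mem r)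
    have hb0 : b ≠ 0 := by
      rintro rfl
      exact hX.ne_zero r (by rw [← hb, zero_smul])
    have key : Y r = (c / b) • X r := by
      rw [← hb, ← hc, smul_smul, div_mul_cancel₀ _ hb0]
    refine ⟨c / b, key, fun hi => ?_⟩
    rw [eq_div_iff hi, key]
    simp
  obtain ⟨i, hi⟩ := Function.ne_iff.1 (hX.ne_zero s)
  have hi' : X s i ≠ 0 := hi
  have hdXi := hasDerivAt_pi.1 hdX i
  have hdYi := hasDerivAt_pi.1 hdY i
  have hα := hdYi.div hdXi hi'
  set α : ℝ → ℝ := (fun r => Y r i) / (fun r => X r i) with hαdef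
  have hev : Y =ᶠ[nhds s] fun r => α r • X r := by
    filter_upwards [hdXi.continuousAt.eventually_ne hi'] with r hr
    obtain ⟨a, ha, ha'⟩ := hXi r i
    rw [ha, ha' hr]
    rfl
  have hY' := (hα.smul hdX).congr_of_eventuallyEq hev |>.deriv
  have hYs : Y s = α s • X s := hev.eq_of_nhds
  have hα0 : α s ≠ 0 := by
    intro h
    exact hY.ne_zero s (by rw [hYs, h, zero_smul])
  have hnull : ∀ r, ip (X r) (X r) = 0 := fun r => (Λ.L r).2 _ (hX.mem r)
  have horth : ip (X s) (deriv X s) = 0 := by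
    have h1 : HasDerivAt (fun r => ip (X r) (X r)) (2 * ip (X s) (deriv X s)) s := by
      have h := hasDerivAt_pi.1 hdX
      have h2 := ((((h 0).mul (h 0)).neg.add ((h 1).mul (h 1))).add
        ((h 2).mul (h 2))).add ((h 3).mul (h 3))
      refine (h2.congr_deriv ?_).congr_of_eventuallyEq (Filter.Eventually.of_forall ?_)
      · rw [ip_eq]
        ring
      · intro r
        simp [ip_eq]
    have h3 : HasDerivAt (fun r => ip (X r) (X r)) 0 s := by
      simp only [hnull]
      exact hasDerivAt_const s 0
    have := h1.unique h3
    linarith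
  generalize hB : deriv Y s = B at *
  generalize hD : deriv X s = D at *
  obtain ⟨b, hb⟩ : ∃ b : ℝ, B = α s • D + b • X s := ⟨_, hY'⟩
  have hn := hnull s
  have hip : ip B B = α s ^ 2 * ip D D := by
    have : ip B B = α s ^ 2 * ip D D + 2 * (α s * b) * ip (X s) D + b ^ 2 * ip (X s) (X s) := by
      rw [hb]
      simp only [ip_eq, Pi.add_apply, Pi.smul_apply, smul_eq_mul]
      ring
    rw [this, hn, horth]
    ring
  have hw : wedge (Y s) B = α s ^ 2 • wedge (X s) D := by
    rw [hYs, hb]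
    ext j k
    simp only [wedge, Matrix.vecMulVec, gram, Matrix.mulVec_diagonal, Matrix.sub_apply,
      Matrix.of_apply, Matrix.smul_apply, Pi.add_apply, Pi.smul_apply, smul_eq_mul]
    ring
  have h2 : α s ^ 2 ≠ 0 := pow_ne_zero 2 hα0
  simp only [eta, hB, hD]
  rw [hip, hw, smul_smul]
  congr 1
  rw [mul_comm (α s ^ 2), ← div_div, div_mul_cancel₀ _ h2]

end LightconeModel

end

/-! Since `q = (dX, dX)`, the connection form is `X ∧ dX`, and along the curve the vector `p + μ X`
is parallel for `d + μ η`, because `(X, p + μ X) = -1` and `(dX, p + μ X) = 0`. Hence the monodromy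
`M μ`, an element of `SO(3,1)`, fixes `p + μ X 0`, whose square norm is `-κ - 2 μ`. For `μ > -κ/2`
this vector is timelike, so `M μ` is a rotation of its definite complement, and its trace is `2 + 2
cos θ`.

The trace is an entire function of `μ` (`LinearODE.analyticOnNhd_solution`) with value `4` at `μ =
0`. If it is constant on the admissible half-line, the identity theorem makes it `4` everywhere, and
a rotation of trace `4` is the identity (`eq_one_of_trace_eq`). Otherwise, by the intermediate value
theorem, `θ` is at some `μ` a rational multiple `2 π m / ℓ` with `2 cos θ ≠ ±2`, and then `M μ ^ ℓ =
1` (`pow_eq_one_of_trace_eq`). This power is the monodromy of the `ℓ`-fold cover. -/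

open scoped Topology Nat NNReal
open MeasureTheory

noncomputable section

/-! ### Linear differential equations: analytic dependence on the spectral parameter. -/

namespace LinearODE

variable {R : Type*} [NormedRing R] [NormedAlgebra ℝ R]

/-- The coefficients of the expansion in `μ` of the solution of `A' = μ E A`, `A 0 = 1`. -/
def picard (E : ℝ → R) : ℕ → ℝ → R
  | 0, _ => 1
  | n + 1, s => ∫ r in (0 : ℝ)..s, E r * picard E n r

/-- The solution of `A' = μ E A`, `A 0 = 1`, as a power series in `μ`. -/
def solution (E : ℝ → R) (μ s : ℝ) : R := ∑' n, μ ^ n • picard E n s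

theorem solution_zero_right (E : ℝ → R) (μ : ℝ) : solution E μ 0 = 1 := by
  rw [solution, tsum_eq_single 0]
  · simp [picard]
  · intro n hn
    obtain ⟨m, rfl⟩ := Nat.exists_eq_succ_of_ne_zero hn
    simp [picard]

theorem solution_zero_left (E : ℝ → R) (s : ℝ) : solution E 0 s = 1 := by
  rw [solution, tsum_eq_single 0]
  · simp [picard]
  · intro n hn
    simp [hn]

variable {E : ℝ → R} {C : ℝ}

theorem continuous_picard (hE : Continuous E) (n : ℕ) : Continuous (picard E n) := by
  induction n with
  | zero => exact continuous_const
  | succ n ih =>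
    exact intervalIntegral.continuous_primitive
      (fun a b => (hE.mul ih).intervalIntegrable a b) 0

theorem hasDerivAt_picard [CompleteSpace R] (hE : Continuous E) (n : ℕ) (s : ℝ) :
    HasDerivAt (picard E (n + 1)) (E s * picard E n s) s :=
  intervalIntegral.integral_hasDerivAt_right
    ((hE.mul (continuous_picard hE n)).intervalIntegrable 0 s)
    ((hE.mul (continuous_picard hE n)).stronglyMeasurableAtFilter _ _)
    (hE.mul (continuous_picard hE n)).continuousAt

/-- The factorial is the volume of the simplex of the iterated integral. The factor `‖1‖` stays
because the norm of `R` need not be normalised. -/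
theorem norm_picard_le (hC : ∀ s, ‖E s‖ ≤ C) (n : ℕ) (s : ℝ) :
    ‖picard E n s‖ ≤ ‖(1 : R)‖ * ((C * |s|) ^ n / n !) := by
  have hC0 : 0 ≤ C := (norm_nonneg _).trans (hC 0)
  induction n generalizing s with
  | zero => simp [picard]
  | succ n ih =>
    have hcont : Continuous fun r : ℝ => ‖(1 : R)‖ * (C ^ (n + 1) / n !) * |r - 0| ^ n := by
      fun_prop
    calc ‖picard E (n + 1) s‖
        ≤ ∫ r in Set.uIoc 0 s, ‖E r * picard E n r‖ :=
          intervalIntegral.norm_integral_le_integral_norm_uIoc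
      _ ≤ ∫ r in Set.uIoc 0 s, ‖(1 : R)‖ * (C ^ (n + 1) / n !) * |r - 0| ^ n := by
          refine integral_mono_of_nonneg (Filter.Eventually.of_forall fun r => norm_nonneg _)
            (intervalIntegrable_iff.1 (hcont.intervalIntegrable 0 s))
            (Filter.Eventually.of_forall fun r => ?_)
          calc ‖E r * picard E n r‖ ≤ ‖E r‖ * ‖picard E n r‖ := norm_mul_le _ _
            _ ≤ C * (‖(1 : R)‖ * ((C * |r|) ^ n / n !)) :=
              mul_le_mul (hC r) (ih r) (norm_nonneg _) hC0
            _ = _ := by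
              simp only [sub_zero]
              rw [mul_pow]
              ring
      _ = ‖(1 : R)‖ * ((C * |s|) ^ (n + 1) / (n + 1)!) := by
          rw [integral_const_mul, integral_pow_abs_sub_uIoc, sub_zero, Nat.factorial_succ,
            mul_pow]
          push_cast
          field_simp

theorem summable_norm_picard (hC : ∀ s, ‖E s‖ ≤ C) (r s : ℝ) :
    Summable fun n => ‖picard E n s‖ * |r| ^ n := by
  refine Summable.of_nonneg_of_le (fun n => by positivity) (fun n => ?_)
    ((Real.summable_pow_div_factorial (C * |s| * |r|)).mul_left ‖(1 : R)‖)
  calc ‖picard E n s‖ * |r| ^ n ≤ ‖(1 : R)‖ * ((C * |s|) ^ n / n !) * |r| ^ n := by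
        gcongr
        exact norm_picard_le hC n s
    _ = _ := by rw [mul_pow (C * |s|)]; ring

theorem summable_solution [CompleteSpace R] (hC : ∀ s, ‖E s‖ ≤ C) (μ s : ℝ) :
    Summable fun n => μ ^ n • picard E n s := by
  refine Summable.of_norm ((summable_norm_picard hC μ s).congr fun n => ?_)
  rw [norm_smul, norm_pow, Real.norm_eq_abs, mul_comm]

theorem norm_smul_mul_picard_le (hC : ∀ s, ‖E s‖ ≤ C) (μ : ℝ) {r ρ : ℝ} (hr : |r| ≤ ρ) (n : ℕ) :
    ‖μ ^ (n + 1) • (E r * picard E n r)‖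
      ≤ |μ| * C * ‖(1 : R)‖ * ((C * ρ * |μ|) ^ n / n !) := by
  have hC0 : 0 ≤ C := (norm_nonneg _).trans (hC 0)
  have hbound : ‖E r * picard E n r‖ ≤ C * (‖(1 : R)‖ * ((C * ρ) ^ n / n !)) := by
    refine (norm_mul_le _ _).trans (mul_le_mul (hC r) ?_ (norm_nonneg _) hC0)
    refine (norm_picard_le hC n r).trans ?_
    gcongr
  rw [norm_smul, norm_pow, Real.norm_eq_abs]
  calc |μ| ^ (n + 1) * ‖E r * picard E n r‖
      ≤ |μ| ^ (n + 1) * (C * (‖(1 : R)‖ * ((C * ρ) ^ n / n !))) :=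
        mul_le_mul_of_nonneg_left hbound (by positivity)
    _ = _ := by rw [mul_pow (C * ρ)]; ring

theorem solution_eq_one_add [CompleteSpace R] (hC : ∀ s, ‖E s‖ ≤ C) (μ s : ℝ) :
    solution E μ s = 1 + ∑' n, μ ^ (n + 1) • picard E (n + 1) s := by
  rw [solution, (summable_solution hC μ s).tsum_eq_zero_add]
  simp [picard]

theorem smul_mul_solution [CompleteSpace R] (hC : ∀ s, ‖E s‖ ≤ C) (μ s : ℝ) :
    μ • (E s * solution E μ s) = ∑' n, μ ^ (n + 1) • (E s * picard E n s) := by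
  rw [solution, ← (summable_solution hC μ s).tsum_mul_left,
    ← ((summable_solution hC μ s).mul_left (E s)).tsum_const_smul μ]
  refine tsum_congr fun n => ?_
  rw [mul_smul_comm, smul_smul, pow_succ']

/-- Termwise differentiation: the differentiated series is dominated uniformly on the ball of radius
`|s| + 1`, which contains both `0` and `s`. -/
theorem hasDerivAt_solution [CompleteSpace R] (hE : Continuous E) (hC : ∀ s, ‖E s‖ ≤ C)
    (μ s : ℝ) : HasDerivAt (solution E μ) (μ • (E s * solution E μ s)) s := by
  have hρ : |s| < |s| + 1 := lt_add_one _
  have hder := hasDerivAt_tsum_of_isPreconnected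
    (g := fun n r => μ ^ (n + 1) • picard E (n + 1) r)
    (g' := fun n r => μ ^ (n + 1) • (E r * picard E n r))
    ((Real.summable_pow_div_factorial (C * (|s| + 1) * |μ|)).mul_left (|μ| * C * ‖(1 : R)‖))
    Metric.isOpen_ball (convex_ball (0 : ℝ) (|s| + 1)).isPreconnected
    (fun n r _ => (hasDerivAt_picard hE n r).fun_const_smul (μ ^ (n + 1)))
    (fun n r hr => norm_smul_mul_picard_le hC μ (by simpa using (mem_ball_zero_iff.1 hr).le) n)
    (Metric.mem_ball_self (by positivity))
    ((summable_nat_add_iff (f := fun n => μ ^ n • picard E n 0) 1).2 (summable_solution hC μ 0))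
    (show s ∈ Metric.ball (0 : ℝ) (|s| + 1) by simp)
  rw [smul_mul_solution hC, funext (solution_eq_one_add hC μ)]
  exact hder.const_add 1

theorem analyticOnNhd_tsum_pow {c : ℕ → ℝ} (hc : ∀ r : ℝ≥0, Summable fun n => ‖c n‖ * (r : ℝ) ^ n) :
    AnalyticOnNhd ℝ (fun μ : ℝ => ∑' n, μ ^ n * c n) Set.univ := by
  have hrad : (FormalMultilinearSeries.ofScalars ℝ c).radius = ⊤ :=
    FormalMultilinearSeries.radius_eq_top_of_summable_norm _ fun r =>
      (hc r).congr fun n => by rw [FormalMultilinearSeries.ofScalars_norm]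
  have h := (FormalMultilinearSeries.hasFPowerSeriesOnBall _ (by rw [hrad]; simp) :
    HasFPowerSeriesOnBall (FormalMultilinearSeries.ofScalars ℝ c).sum _ _ _).analyticOnNhd
  rw [hrad, Metric.eball_top] at h
  refine h.congr isOpen_univ fun μ _ => ?_
  rw [show (FormalMultilinearSeries.ofScalars ℝ c).sum μ
    = FormalMultilinearSeries.ofScalarsSum c μ from rfl,
    FormalMultilinearSeries.ofScalars_sum_eq]
  exact tsum_congr fun n => by rw [smul_eq_mul, mul_comm]

theorem analyticOnNhd_solution [CompleteSpace R] (hC : ∀ s, ‖E s‖ ≤ C) (f : R →L[ℝ] ℝ) (s : ℝ) :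
    AnalyticOnNhd ℝ (fun μ => f (solution E μ s)) Set.univ := by
  have h : (fun μ => f (solution E μ s)) = fun μ => ∑' n, μ ^ n * f (picard E n s) := by
    funext μ
    rw [solution, f.map_tsum (summable_solution hC μ s)]
    simp
  rw [h]
  refine analyticOnNhd_tsum_pow fun r => ?_
  refine Summable.of_nonneg_of_le (fun n => by positivity) (fun n => ?_)
    ((summable_norm_picard hC r s).mul_left ‖f‖)
  rw [← mul_assoc, abs_of_nonneg r.coe_nonneg]
  gcongr
  exact f.le_opNorm _

end LinearODE

/-! ### Algebra of Lorentz isometries with a fixed vector. -/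

namespace LightconeModel

open Matrix Polynomial

theorem gram_mul_gram : gram * gram = 1 := by
  rw [gram, Matrix.diagonal_mul_diagonal, ← Matrix.diagonal_one]
  congr 1
  funext i
  fin_cases i <;> simp

/-- The trace of an element of `SO(3,1)` with eigenvalue `1` determines its characteristic
polynomial. -/
theorem charpoly_eq_of_isometry {M : Matrix (Fin 4) (Fin 4) ℝ} (hM : Mᵀ * gram * M = gram)
    (hdet : M.det = 1) {v : V} (hv : v ≠ 0) (hMv : M *ᵥ v = v) :
    M.charpoly = (X - C 1) ^ 2 * (X ^ 2 - C (M.trace - 2) * X + 1) := by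
  have hinv : (gram * Mᵀ * gram) * M = 1 := by
    rw [Matrix.mul_assoc, Matrix.mul_assoc, ← Matrix.mul_assoc Mᵀ, hM, gram_mul_gram]
  have hinv' : M⁻¹ = gram * Mᵀ * gram := Matrix.inv_eq_left_inv hinv
  -- The inverse is conjugate to the transpose by `gram`. With determinant `1` this makes the
  -- characteristic polynomial palindromic, and the eigenvalue `1` then fixes its middle
  -- coefficient.
  have hcp : M⁻¹.charpoly = M.charpoly := by
    rw [hinv', Matrix.mul_assoc, Matrix.charpoly_mul_comm, Matrix.mul_assoc, gram_mul_gram,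
      Matrix.mul_one, Matrix.charpoly_transpose]
  have hunit : IsUnit M := (Matrix.isUnit_iff_isUnit_det M).2 (by simp [hdet])
  have hrev : M.charpoly.reverse = M.charpoly := by
    have h := Matrix.charpoly_inv M hunit
    rw [hcp, hdet] at h
    rw [Matrix.reverse_charpoly]
    simpa [Even.neg_one_pow (by decide : Even 4)] using h.symm
  have hnat : M.charpoly.natDegree = 4 := by simp
  have h4 : M.charpoly.coeff 4 = 1 := by
    have := M.charpoly_monic.coeff_natDegree
    rwa [hnat] at this
  have h3 : M.charpoly.coeff 3 = -M.trace := by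
    rw [Matrix.trace_eq_neg_charpoly_coeff]
    simp
  have h0 : M.charpoly.coeff 0 = 1 := by
    have := Matrix.det_eq_sign_charpoly_coeff M
    rw [hdet] at this
    simpa [Even.neg_one_pow (by decide : Even 4)] using this.symm
  have h1 : M.charpoly.coeff 1 = -M.trace := by
    rw [← hrev, Polynomial.coeff_reverse, hnat, ← h3]
    rfl
  have hsum : M.charpoly = C (M.charpoly.coeff 0) + C (M.charpoly.coeff 1) * X
      + C (M.charpoly.coeff 2) * X ^ 2 + C (M.charpoly.coeff 3) * X ^ 3
      + C (M.charpoly.coeff 4) * X ^ 4 := by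
    conv_lhs => rw [M.charpoly.as_sum_range_C_mul_X_pow, hnat]
    simp [Finset.sum_range_succ]
  have hroot : M.charpoly.eval 1 = 0 := by
    rw [Matrix.eval_charpoly]
    refine Matrix.exists_mulVec_eq_zero_iff.1 ⟨v, hv, ?_⟩
    simp [Matrix.sub_mulVec, hMv]
  have h2 : M.charpoly.coeff 2 = 2 * M.trace - 2 := by
    rw [hsum] at hroot
    simp only [eval_add, eval_mul, eval_C, eval_X, eval_pow, h0, h1, h3, h4] at hroot
    linarith
  rw [hsum, h0, h1, h2, h3, h4]
  simp only [map_sub, map_neg, map_mul, map_one, C_ofNat]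
  ring

/-- The reflection of a form of signature `(- + + +)` in a timelike vector is definite. -/
theorem ip_add_sq_pos {v : V} (hv : ip v v < 0) {u : V} (hu : u ≠ 0) :
    0 < -ip v v * ip u u + 2 * ip u v ^ 2 := by
  have hD : 0 < -ip v v := neg_pos.2 hv
  have hS : 0 < v 0 ^ 2 + v 1 ^ 2 + v 2 ^ 2 + v 3 ^ 2 := by
    rw [ip_eq] at hv
    nlinarith [sq_nonneg (v 1), sq_nonneg (v 2), sq_nonneg (v 3)]
  refine pos_of_mul_pos_right (a := v 0 ^ 2 + v 1 ^ 2 + v 2 ^ 2 + v 3 ^ 2) ?_ hS.le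
  -- The multiplier is the coefficient of `u 0 ^ 2` in the quadratic form in `u`; the identity
  -- completes the square in `u 0`, and Lagrange's identity handles the rest.
  have key : (v 0 ^ 2 + v 1 ^ 2 + v 2 ^ 2 + v 3 ^ 2) * (-ip v v * ip u u + 2 * ip u v ^ 2)
      = ((v 0 ^ 2 + v 1 ^ 2 + v 2 ^ 2 + v 3 ^ 2) * u 0
          - 2 * v 0 * (u 1 * v 1 + u 2 * v 2 + u 3 * v 3)) ^ 2
        + (-ip v v) ^ 2 * (u 1 ^ 2 + u 2 ^ 2 + u 3 ^ 2)
        + 2 * (-ip v v) * ((u 1 * v 2 - u 2 * v 1) ^ 2 + (u 1 * v 3 - u 3 * v 1) ^ 2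
          + (u 2 * v 3 - u 3 * v 2) ^ 2) := by
    simp only [ip_eq]
    ring
  rw [key]
  by_cases h : u 1 = 0 ∧ u 2 = 0 ∧ u 3 = 0
  · obtain ⟨h1, h2, h3⟩ := h
    have h0 : u 0 ≠ 0 := by
      intro h0
      apply hu
      funext i
      fin_cases i <;> assumption
    have : 0 < ((v 0 ^ 2 + v 1 ^ 2 + v 2 ^ 2 + v 3 ^ 2) * u 0) ^ 2 := by positivity
    simpa [h1, h2, h3] using this
  · have : 0 < u 1 ^ 2 + u 2 ^ 2 + u 3 ^ 2 := by
      by_contra hle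
      apply h
      refine ⟨?_, ?_, ?_⟩ <;> nlinarith [sq_nonneg (u 1), sq_nonneg (u 2), sq_nonneg (u 3)]
    positivity

/-- An isometry fixing a timelike vector is semisimple at the eigenvalue `1`. -/
theorem fixed_of_sq_fixed {M : Matrix (Fin 4) (Fin 4) ℝ}
    (hM : ∀ x y, ip (M *ᵥ x) (M *ᵥ y) = ip x y) {v : V} (hv : ip v v < 0) (hMv : M *ᵥ v = v)
    {y : V} (hy : M *ᵥ (M *ᵥ y - y) = M *ᵥ y - y) : M *ᵥ y = y := by
  by_contra hne
  have hz : M *ᵥ y - y ≠ 0 := sub_ne_zero.2 hne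
  set z := M *ᵥ y - y with hzdef
  have hpos := ip_add_sq_pos hv hz
  -- The orbit is `y`, `y + z`, `y + 2 z`. Its constant square norm forces `z` to be null, its
  -- constant product with `v` forces `z ⊥ v`, and only `z = 0` is both.
  have e1 : M *ᵥ y = y + z := by rw [hzdef]; abel
  have e2 : M *ᵥ (y + z) = y + z + z := by rw [Matrix.mulVec_add, hy, e1]
  have a1 := hM y y
  have a2 := hM (y + z) (y + z)
  have b := hM z v
  have b1 := hM y v
  rw [e2] at a2
  rw [e1] at a1
  rw [e1, hMv] at b1
  have c0 : ip z v = 0 := by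
    simp only [ip_eq, Pi.add_apply] at b1 ⊢
    linarith
  have c1 : ip z z = 0 := by
    simp only [ip_eq, Pi.add_apply] at a1 a2 ⊢
    linarith
  rw [c0, c1] at hpos
  simp at hpos

theorem ip_mulVec_mulVec {M : Matrix (Fin 4) (Fin 4) ℝ} (hM : Mᵀ * gram * M = gram) (x y : V) :
    ip (M *ᵥ x) (M *ᵥ y) = ip x y := by
  have hg : gramᵀ = gram := by rw [gram, Matrix.diagonal_transpose]
  have e : ∀ a b : V, ip a b = a ⬝ᵥ gram *ᵥ b := fun a b => by
    rw [ip, Matrix.dotProduct_mulVec, ← Matrix.mulVec_transpose, hg]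
  rw [e, e, ← Matrix.vecMul_transpose, ← Matrix.dotProduct_mulVec, Matrix.mulVec_mulVec,
    Matrix.mulVec_mulVec, hM]

/-- Semisimplicity: the factor `X - 1` of the characteristic polynomial need only be used once. -/
theorem mul_eq_zero_of_isometry {M : Matrix (Fin 4) (Fin 4) ℝ} (hM : Mᵀ * gram * M = gram)
    (hdet : M.det = 1) {v : V} (hv : ip v v < 0) (hMv : M *ᵥ v = v) :
    (M - 1) * (M ^ 2 - (M.trace - 2) • M + 1) = 0 := by
  have hv0 : v ≠ 0 := by
    rintro rfl
    simp [ip_eq] at hv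
  have hch := M.aeval_self_charpoly
  rw [charpoly_eq_of_isometry hM hdet hv0 hMv, ← smul_eq_C_mul] at hch
  simp only [map_mul, map_pow, map_sub, map_add, map_smul, aeval_X, map_one] at hch
  refine Matrix.toLin'.injective (LinearMap.ext fun x => ?_)
  -- By Cayley–Hamilton, `(M - 1) ^ 2` kills the image of `x` under the quadratic factor;
  -- semisimplicity at `1` removes one power.
  have hx := congrArg (fun N : Matrix (Fin 4) (Fin 4) ℝ => N *ᵥ x) hch
  simp only [pow_two (M - 1), Matrix.mul_assoc, Matrix.zero_mulVec] at hx
  rw [← Matrix.mulVec_mulVec, ← Matrix.mulVec_mulVec, Matrix.sub_mulVec, Matrix.sub_mulVec,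
    Matrix.one_mulVec, Matrix.one_mulVec] at hx
  rw [Matrix.toLin'_apply, ← Matrix.mulVec_mulVec, Matrix.sub_mulVec, Matrix.one_mulVec,
    fixed_of_sq_fixed (ip_mulVec_mulVec hM) hv hMv (sub_eq_zero.1 hx)]
  simp

/-- Otherwise the quadratic factor has a real root `r ≠ ±1`. Its eigenvector is null and orthogonal
to the timelike `v`, hence zero. -/
theorem abs_trace_sub_two_le {M : Matrix (Fin 4) (Fin 4) ℝ} (hM : Mᵀ * gram * M = gram)
    (hdet : M.det = 1) {v : V} (hv : ip v v < 0) (hMv : M *ᵥ v = v) :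
    |M.trace - 2| ≤ 2 := by
  have hv0 : v ≠ 0 := by
    rintro rfl
    simp [ip_eq] at hv
  by_contra! hlt
  set c := M.trace - 2 with hc
  have hsq : 0 < c ^ 2 - 4 := by
    have : 2 ^ 2 < |c| ^ 2 := by gcongr
    rw [sq_abs] at this
    linarith
  obtain ⟨r, hr⟩ : ∃ r : ℝ, r ^ 2 - c * r + 1 = 0 := by
    refine ⟨(c + √(c ^ 2 - 4)) / 2, ?_⟩
    have := Real.sq_sqrt hsq.le
    linear_combination this / 4
  have hr1 : r ^ 2 ≠ 1 := by
    intro h1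
    have : c ^ 2 = 4 := by
      have h2 : c * r = 2 := by linarith
      have h3 : (c * r) ^ 2 = 4 := by rw [h2]; norm_num
      rwa [mul_pow, h1, mul_one] at h3
    linarith
  have heval : M.charpoly.eval r = 0 := by
    rw [charpoly_eq_of_isometry hM hdet hv0 hMv, ← hc]
    simp [hr]
  rw [Matrix.eval_charpoly] at heval
  obtain ⟨y, hy0, hy⟩ := Matrix.exists_mulVec_eq_zero_iff.2 heval
  have hMy : M *ᵥ y = r • y := by
    rw [Matrix.sub_mulVec, sub_eq_zero] at hy
    rw [← hy]
    simp [Matrix.scalar_apply, Matrix.diagonal_const_mulVec]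
  have h1 := ip_mulVec_mulVec hM y y
  have h2 := ip_mulVec_mulVec hM y v
  rw [hMy] at h1 h2
  rw [hMv] at h2
  have h1' : (r ^ 2 - 1) * ip y y = 0 := by
    simp only [ip_eq, Pi.smul_apply, smul_eq_mul] at h1 ⊢
    linear_combination h1
  have h2' : (r - 1) * ip y v = 0 := by
    simp only [ip_eq, Pi.smul_apply, smul_eq_mul] at h2 ⊢
    linear_combination h2
  have hpos := ip_add_sq_pos hv hy0
  rw [(mul_eq_zero.1 h1').resolve_left (sub_ne_zero.2 hr1),
    (mul_eq_zero.1 h2').resolve_left (fun h => hr1 (by rw [sub_eq_zero.1 h, one_pow]))] at hpos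
  simp at hpos

/-- At trace `4` the quadratic factor is `(M - 1) ^ 2`, so `(M - 1) ^ 3 = 0`; using semisimplicity
at `1` twice lowers the exponent to one. -/
theorem eq_one_of_trace_eq {M : Matrix (Fin 4) (Fin 4) ℝ} (hM : Mᵀ * gram * M = gram)
    (hdet : M.det = 1) {v : V} (hv : ip v v < 0) (hMv : M *ᵥ v = v) (htr : M.trace = 4) :
    M = 1 := by
  have h := mul_eq_zero_of_isometry hM hdet hv hMv
  have h2 : M ^ 2 - (M.trace - 2) • M + 1 = (M - 1) * (M - 1) := by
    rw [htr, show (4 : ℝ) - 2 = 2 by norm_num, two_smul]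
    noncomm_ring
  rw [h2] at h
  have hfix : ∀ x, (M - 1) *ᵥ ((M - 1) *ᵥ x) = 0 → (M - 1) *ᵥ x = 0 := by
    intro x hx
    rw [Matrix.sub_mulVec M 1 x, Matrix.sub_mulVec, Matrix.one_mulVec, Matrix.one_mulVec] at hx
    rw [Matrix.sub_mulVec, Matrix.one_mulVec,
      fixed_of_sq_fixed (ip_mulVec_mulVec hM) hv hMv (sub_eq_zero.1 hx), sub_self]
  refine sub_eq_zero.1 (Matrix.toLin'.injective (LinearMap.ext fun x => ?_))
  rw [Matrix.toLin'_apply, map_zero, LinearMap.zero_apply]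
  refine hfix x (hfix _ ?_)
  rw [Matrix.mulVec_mulVec, Matrix.mulVec_mulVec, Matrix.mul_assoc, h, Matrix.zero_mulVec]

/-- The annihilating cubic has the roots `1` and `exp (± i θ)`, all of them `ℓ`-th roots of unity.
The strict bound makes them distinct, so the cubic divides `X ^ ℓ - 1`. -/
theorem pow_eq_one_of_trace_eq {M : Matrix (Fin 4) (Fin 4) ℝ}
    (h : (M - 1) * (M ^ 2 - (M.trace - 2) • M + 1) = 0) {m : ℤ} {ℓ : ℕ} (hℓ : 1 ≤ ℓ)
    (hc : M.trace - 2 = 2 * Real.cos (2 * Real.pi * (m / ℓ)))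
    (hlt : |M.trace - 2| < 2) : M ^ ℓ = 1 := by
  set θ : ℝ := 2 * Real.pi * (m / ℓ) with hθ
  set w : ℂ := Complex.exp (θ * Complex.I) with hw
  set w' : ℂ := Complex.exp (-(θ * Complex.I)) with hw'
  have hmul : w * w' = 1 := by rw [hw, hw', ← Complex.exp_add, add_neg_cancel, Complex.exp_zero]
  have hadd : w + w' = ((M.trace - 2 : ℝ) : ℂ) := by
    rw [hc]
    push_cast
    rw [Complex.two_cos, neg_mul]
  have hθℓ : (ℓ : ℂ) * (θ * Complex.I) = m * (2 * Real.pi * Complex.I) := by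
    have : (ℓ : ℂ) ≠ 0 := by exact_mod_cast (by omega : ℓ ≠ 0)
    rw [hθ]
    push_cast
    field_simp
  have hwℓ : w ^ ℓ = 1 := by
    rw [hw, ← Complex.exp_nat_mul, hθℓ, Complex.exp_int_mul_two_pi_mul_I]
  have hwℓ' : w' ^ ℓ = 1 := by
    have := congrArg (· ^ ℓ) hmul
    simpa [mul_pow, hwℓ] using this
  -- If `x ^ 2 = 1` then `y = x`, so the sum squares to `4`, against the strict bound. Every
  -- coincidence among the three roots reduces to this.
  have hsq : ∀ x y : ℂ, x * y = 1 → x + y = ((M.trace - 2 : ℝ) : ℂ) → x ^ 2 ≠ 1 := by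
    intro x y hxy hs hx
    have hyx : y = x := by linear_combination x * hxy - y * hx
    have hc4 : (((M.trace - 2) ^ 2 : ℝ) : ℂ) = (4 : ℝ) := by
      rw [Complex.ofReal_pow, ← hs, hyx]
      push_cast
      linear_combination 4 * hx
    have hc4' : (M.trace - 2) ^ 2 = 4 := Complex.ofReal_injective hc4
    have : |M.trace - 2| ^ 2 < 2 ^ 2 := by gcongr
    rw [sq_abs] at this
    linarith
  have h1 : w ≠ 1 := fun e => hsq w w' hmul hadd (by rw [e, one_pow])
  have h1' : w' ≠ 1 := fun e =>
    hsq w' w (by rw [mul_comm, hmul]) (by rw [add_comm, hadd]) (by rw [e, one_pow])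
  have hne : w ≠ w' := by
    intro he
    refine hsq w w' hmul hadd ?_
    rw [pow_two]
    nth_rewrite 2 [he]
    exact hmul
  have hcop : ∀ {a b : ℂ}, a ≠ b → IsCoprime (X - C a) (X - C b) := fun hab =>
    isCoprime_X_sub_C_of_isUnit_sub (sub_ne_zero.2 hab).isUnit
  have hroot : ∀ {a : ℂ}, a ^ ℓ = 1 → (X - C a) ∣ (X ^ ℓ - 1 : ℂ[X]) := fun ha =>
    dvd_iff_isRoot.2 (by simp [ha])
  have hdvd : (X - C 1) * ((X - C w) * (X - C w')) ∣ (X ^ ℓ - 1 : ℂ[X]) :=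
    ((hcop h1.symm).mul_right (hcop h1'.symm)).mul_dvd (hroot (one_pow ℓ))
      ((hcop hne).mul_dvd (hroot hwℓ) (hroot hwℓ'))
  obtain ⟨g, hg⟩ := hdvd
  have hquadratic : (X - C w) * (X - C w') = X ^ 2 - ((M.trace - 2 : ℝ) : ℂ) • X + (1 : ℂ[X]) := by
    rw [← hadd, smul_eq_C_mul, map_add, ← C_1, ← hmul, map_mul]
    ring
  rw [hquadratic] at hg
  have hmap : (M.map Complex.ofReal - 1) * ((M.map Complex.ofReal) ^ 2
      - ((M.trace - 2 : ℝ) : ℂ) • M.map Complex.ofReal + 1) = 0 := by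
    have := congrArg (Complex.ofRealHom.mapMatrix) h
    simp only [map_mul, map_sub, map_add, map_pow, map_one, map_zero] at this
    rw [← this]
    congr 3
    ext i j
    simp
  have hpow := congrArg (aeval (M.map Complex.ofReal)) hg
  simp only [map_mul, map_sub, map_add, map_pow, map_one, map_smul, aeval_X, hmap,
    zero_mul] at hpow
  have : (Complex.ofRealHom.mapMatrix) (M ^ ℓ) = Complex.ofRealHom.mapMatrix 1 := by
    rw [map_pow, map_one]
    exact sub_eq_zero.1 hpow
  exact (Matrix.map_injective Complex.ofReal_injective) this

theorem exists_rational_angle {a b : ℝ} (hab : a < b) (ha : -2 ≤ a) (hb : b ≤ 2) :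
    ∃ (m : ℤ) (ℓ : ℕ), 1 ≤ ℓ ∧ 2 * Real.cos (2 * Real.pi * (m / ℓ)) ∈ Set.Ioo a b := by
  have hopen : IsOpen ((fun t : ℝ => 2 * Real.cos (2 * Real.pi * t)) ⁻¹' Set.Ioo a b) :=
    isOpen_Ioo.preimage (by fun_prop)
  obtain ⟨r, hr⟩ := Rat.denseRange_cast (𝕜 := ℝ).exists_mem_open hopen
    -- Here `2 cos` takes the midpoint of `a` and `b`; a nearby rational still lands between them.
    ⟨Real.arccos ((a + b) / 4) / (2 * Real.pi), by
      have : 2 * Real.pi * (Real.arccos ((a + b) / 4) / (2 * Real.pi))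
        = Real.arccos ((a + b) / 4) := by field_simp
      simp only [Set.mem_preimage, this]
      rw [Real.cos_arccos (by linarith) (by linarith)]
      constructor <;> linarith⟩
  refine ⟨r.num, r.den, r.pos, ?_⟩
  have := r.cast_def (K := ℝ)
  rw [← this]
  exact hr

end LightconeModel

/-! ### The flow of a skew connection and its monodromy. -/

namespace LightconeModel

open Matrix

attribute [local instance] Matrix.linftyOpNormedRing Matrix.linftyOpNormedAlgebra

section Flow

variable {E A B : ℝ → Matrix (Fin 4) (Fin 4) ℝ} {μ : ℝ}

/-- Allowing two solutions serves two purposes: `B = A` shows that the flow is isometric, and a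
general `B` gives uniqueness of solutions. -/
theorem transpose_mul_gram_mul_const (hE : ∀ s, (E s)ᵀ * gram + gram * E s = 0)
    (hA : ∀ s, HasDerivAt A (μ • (E s * A s)) s) (hB : ∀ s, HasDerivAt B (μ • (E s * B s)) s)
    (s : ℝ) : (A s)ᵀ * gram * B s = (A 0)ᵀ * gram * B 0 := by
  have hAt : ∀ s, HasDerivAt (fun r => (A r)ᵀ) (μ • (E s * A s))ᵀ s := fun s =>
    (LinearMap.toContinuousLinearMap
      (Matrix.transposeLinearEquiv (Fin 4) (Fin 4) ℝ ℝ).toLinearMap).hasFDerivAt.comp_hasDerivAt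
        s (hA s)
  have hder : ∀ s, HasDerivAt (fun r => (A r)ᵀ * gram * B r) 0 s := fun s => by
    refine (((hAt s).mul_const gram).mul (hB s)).congr_deriv ?_
    have : (μ • (E s * A s))ᵀ * gram * B s + (A s)ᵀ * gram * (μ • (E s * B s))
        = μ • ((A s)ᵀ * ((E s)ᵀ * gram + gram * E s) * B s) := by
      simp only [Matrix.transpose_smul, Matrix.transpose_mul, smul_mul_assoc, mul_smul_comm,
        Matrix.mul_assoc, Matrix.mul_add, Matrix.add_mul, smul_add]
    rw [this, hE]
    simp
  exact is_const_of_deriv_eq_zero (fun s => (hder s).differentiableAt)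
    (fun s => (hder s).deriv) s 0

theorem transpose_mul_gram_mul_self (hE : ∀ s, (E s)ᵀ * gram + gram * E s = 0)
    (hA : ∀ s, HasDerivAt A (μ • (E s * A s)) s) (hA0 : A 0 = 1) (s : ℝ) :
    (A s)ᵀ * gram * A s = gram := by
  simpa [hA0] using transpose_mul_gram_mul_const hE hA hA s

theorem eq_mul_of_hasDerivAt (hE : ∀ s, (E s)ᵀ * gram + gram * E s = 0)
    (hA : ∀ s, HasDerivAt A (μ • (E s * A s)) s) (hA0 : A 0 = 1)
    (hB : ∀ s, HasDerivAt B (μ • (E s * B s)) s) (s : ℝ) : B s = A s * B 0 := by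
  have h1 : (A s)ᵀ * gram * B s = gram * B 0 := by
    simpa [hA0] using transpose_mul_gram_mul_const hE hA hB s
  have h2 : gram * ((A s)ᵀ * gram) * A s = 1 := by
    rw [Matrix.mul_assoc, transpose_mul_gram_mul_self hE hA hA0, gram_mul_gram]
  calc B s = A s * (gram * ((A s)ᵀ * gram)) * B s := by rw [mul_eq_one_comm.1 h2, Matrix.one_mul]
    _ = A s * (gram * ((A s)ᵀ * gram * B s)) := by simp only [Matrix.mul_assoc]
    _ = A s * B 0 := by rw [h1, ← Matrix.mul_assoc gram, gram_mul_gram, Matrix.one_mul]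

theorem det_eq_one_of_hasDerivAt (hE : ∀ s, (E s)ᵀ * gram + gram * E s = 0)
    (hA : ∀ s, HasDerivAt A (μ • (E s * A s)) s) (hA0 : A 0 = 1) (s : ℝ) : (A s).det = 1 := by
  have hG : gram.det ≠ 0 := by
    intro h
    have := congrArg Matrix.det gram_mul_gram
    simp [Matrix.det_mul, h] at this
  have hsq : ∀ r, (A r).det * (A r).det = 1 := fun r => by
    have := congrArg Matrix.det (transpose_mul_gram_mul_self hE hA hA0 r)
    rw [Matrix.det_mul, Matrix.det_mul, Matrix.det_transpose] at this
    refine mul_right_cancel₀ hG ?_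
    linear_combination this
  -- The determinant is `±1` everywhere and `1` at `0`; reaching `-1` would force a zero in between.
  have hcont : Continuous fun r => (A r).det :=
    (continuous_iff_continuousAt.2 fun r => (hA r).continuousAt).matrix_det
  rcases mul_self_eq_one_iff.1 (hsq s) with h | h
  · exact h
  · obtain ⟨r, hr⟩ := mem_range_of_exists_le_of_exists_ge (c := 0) hcont ⟨s, by simp [h]⟩
      ⟨0, by simp [hA0]⟩
    have := hsq r
    simp [hr] at this

/-- By periodicity `s ↦ A (s + T)` is again a solution, so uniqueness gives `A (s + T) = A s * A T`.
-/
theorem apply_nat_mul_period (hE : ∀ s, (E s)ᵀ * gram + gram * E s = 0)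
    (hA : ∀ s, HasDerivAt A (μ • (E s * A s)) s) (hA0 : A 0 = 1) {T : ℝ}
    (hper : ∀ s, E (s + T) = E s) (ℓ : ℕ) : A (ℓ * T) = A T ^ ℓ := by
  induction ℓ with
  | zero => simp [hA0]
  | succ n ih =>
    have h := eq_mul_of_hasDerivAt hE hA hA0 (B := fun s => A (s + T))
      (fun s => by
        have := (hA (s + T)).comp_add_const s T
        rwa [hper] at this) (n * T)
    rw [zero_add, ih, ← pow_succ] at h
    rw [← h]
    push_cast
    ring_nf

theorem mulVec_of_hasDerivAt (hE : ∀ s, (E s)ᵀ * gram + gram * E s = 0)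
    (hA : ∀ s, HasDerivAt A (μ • (E s * A s)) s) (hA0 : A 0 = 1) {v : ℝ → V}
    (hv : ∀ s, HasDerivAt v (μ • (E s *ᵥ v s)) s) (s : ℝ) : A s *ᵥ v 0 = v s := by
  -- The vector solution becomes a matrix solution with all four columns equal to it; column `0` is
  -- read off at the end.
  have h := eq_mul_of_hasDerivAt hE hA hA0 (B := fun s => Matrix.vecMulVec (v s) 1)
    (fun s => by
      have := (LinearMap.toContinuousLinearMap
        (({ toFun := fun w => Matrix.vecMulVec w 1
            map_add' := fun a b => Matrix.add_vecMulVec a b 1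
            map_smul' := fun c a => Matrix.smul_vecMulVec c a 1 } :
          V →ₗ[ℝ] Matrix (Fin 4) (Fin 4) ℝ))).hasFDerivAt.comp_hasDerivAt s (hv s)
      refine this.congr_deriv ?_
      rw [Matrix.mul_vecMulVec]
      exact Matrix.smul_vecMulVec μ (E s *ᵥ v s) 1) s
  rw [Matrix.mul_vecMulVec] at h
  funext i
  have := congrFun (congrFun h i) 0
  simpa [Matrix.vecMulVec_apply] using this.symm

end Flow

/-! ### From the parallel vector `p + μ X` to resonance points. -/

theorem wedge_skew (x y : V) : (wedge x y)ᵀ * gram + gram * wedge x y = 0 := by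
  ext i j
  fin_cases i <;> fin_cases j <;>
    simp [wedge, gram, Matrix.vecMulVec_apply, Matrix.mulVec_diagonal]

theorem continuous_wedge {x y : ℝ → V} (hx : Continuous x) (hy : Continuous y) :
    Continuous fun s => wedge (x s) (y s) := by
  unfold wedge
  fun_prop

theorem hasDerivAt_ip {f g : ℝ → V} {f' g' : V} {s : ℝ} (hf : HasDerivAt f f' s)
    (hg : HasDerivAt g g' s) :
    HasDerivAt (fun r => ip (f r) (g r)) (ip f' (g s) + ip (f s) g') s := by
  have hf := hasDerivAt_pi.1 hf
  have hg := hasDerivAt_pi.1 hg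
  have h := ((((hf 0).mul (hg 0)).neg.add ((hf 1).mul (hg 1))).add
    ((hf 2).mul (hg 2))).add ((hf 3).mul (hg 3))
  refine (h.congr_deriv ?_).congr_of_eventuallyEq (Filter.Eventually.of_forall fun r => ?_)
  · simp only [ip_eq]
    ring
  · simp [ip_eq]

theorem isDiagonalisable_one : IsDiagonalisable 1 :=
  ⟨1, 1, isUnit_one, by simp⟩

/-- A nonconstant continuous function on an interval with values in `[-2, 2]` takes a value
`2 cos (2 π r)` with `r` rational, other than `±2`. -/
theorem exists_rational_angle_of_ne {f : ℝ → ℝ} (hf : Continuous f) {J : Set ℝ}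
    (hJ : IsPreconnected J) (hbound : ∀ μ ∈ J, |f μ| ≤ 2) {a b : ℝ} (ha : a ∈ J) (hb : b ∈ J)
    (hab : f a < f b) :
    ∃ μ ∈ J, ∃ (m : ℤ) (ℓ : ℕ), 1 ≤ ℓ ∧ f μ = 2 * Real.cos (2 * Real.pi * (m / ℓ)) ∧ |f μ| < 2 := by
  have ha2 := (abs_le.1 (hbound a ha)).1
  have hb2 := (abs_le.1 (hbound b hb)).2
  obtain ⟨m, l, hl, hm⟩ := exists_rational_angle hab ha2 hb2
  obtain ⟨μ, hμ, hfμ⟩ := hJ.intermediate_value ha hb hf.continuousOn ⟨hm.1.le, hm.2.le⟩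
  exact ⟨μ, hμ, m, l, hl, hfμ, by
    rw [hfμ, abs_lt]
    constructor <;> linarith [hm.1, hm.2]⟩

/-- A curve polarised by its arc-length in a space form has resonance points. -/
theorem exists_resonancePoint_of_arcLength (Λ : PolarisedCurve) (T κ : ℝ) (p : V)
    (hp : ip p p = -κ) (X : ℝ → V) (hX : IsLift Λ.L X) (hcurve : IsClosedCurveIn p T X)
    (harc : ∀ s, Λ.q s = ip (deriv X s) (deriv X s)) (hT : 0 < T) :
    ∃ μ : ℝ, -κ / 2 < μ ∧ ∃ ℓ : ℕ, 1 ≤ ℓ ∧ Λ.IsResonancePoint (ℓ * T) μ := by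
  -- The sign turns `dA = -μ η A` into `A' = μ E A`.
  set E : ℝ → Matrix (Fin 4) (Fin 4) ℝ := fun s => -wedge (X s) (deriv X s) with hEdef
  have heta : ∀ s, Λ.eta X s = -E s := fun s => by
    rw [PolarisedCurve.eta, harc, div_self (hcurve.regular s).ne', one_smul, hEdef, neg_neg]
  have hdX : ∀ s, HasDerivAt X (deriv X s) s := fun s =>
    (hX.smooth.differentiable (by simp) s).hasDerivAt
  have hdper : ∀ s, deriv X (s + T) = deriv X s := fun s => by
    rw [← deriv_comp_add_const, funext hcurve.periodic]
  have hEper : ∀ s, E (s + T) = E s := fun s => by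
    simp only [hEdef, hdper, hcurve.periodic]
  have hEcont : Continuous E :=
    (continuous_wedge hX.smooth.continuous (hX.smooth.continuous_deriv (by simp))).neg
  have hEskew : ∀ s, (E s)ᵀ * gram + gram * E s = 0 := fun s => by
    have := wedge_skew (X s) (deriv X s)
    simp only [hEdef, Matrix.transpose_neg, Matrix.neg_mul, Matrix.mul_neg]
    rw [← neg_add, this, neg_zero]
  obtain ⟨C, hC⟩ : ∃ C, ∀ s, ‖E s‖ ≤ C := by
    obtain ⟨C, hC⟩ := (Function.Periodic.isBounded_of_continuous (f := E) hEper hT.ne'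
      hEcont).exists_norm_le
    exact ⟨C, fun s => hC _ (Set.mem_range_self s)⟩
  have hA := fun μ => LinearODE.hasDerivAt_solution hEcont hC μ
  have hA0 := fun μ => LinearODE.solution_zero_right E μ
  set M : ℝ → Matrix (Fin 4) (Fin 4) ℝ := fun μ => LinearODE.solution E μ T with hMdef
  have hiso : ∀ μ, (M μ)ᵀ * gram * M μ = gram := fun μ =>
    transpose_mul_gram_mul_self hEskew (hA μ) (hA0 μ) T
  have hdet : ∀ μ, (M μ).det = 1 := fun μ => det_eq_one_of_hasDerivAt hEskew (hA μ) (hA0 μ) T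
  have hv : ∀ μ s : ℝ, HasDerivAt (fun r => p + μ • X r) (μ • (E s *ᵥ (p + μ • X s))) s := by
    intro μ s
    refine (((hdX s).const_smul μ).const_add p).congr_deriv ?_
    have h0 : ∀ r, ip (X r) (X r) = 0 := fun r => (hcurve.mem r).1
    have h1 : ∀ r, ip (X r) p = -1 := fun r => (hcurve.mem r).2
    have h2 : ip (deriv X s) p = 0 := by
      have h := hasDerivAt_ip (hdX s) (hasDerivAt_const s p)
      simp only [h1] at h
      have := h.unique (hasDerivAt_const s (-1))
      simpa [ip_eq] using this
    have h3 : ip (deriv X s) (X s) = 0 := by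
      have h := hasDerivAt_ip (hdX s) (hdX s)
      simp only [h0] at h
      have := h.unique (hasDerivAt_const s 0)
      rw [ip_eq, ip_eq] at this
      rw [ip_eq]
      linarith
    have e : ∀ x, ip x (p + μ • X s) = ip x p + μ * ip x (X s) := fun x => by
      simp only [ip_eq, Pi.add_apply, Pi.smul_apply, smul_eq_mul]
      ring
    rw [hEdef, Matrix.neg_mulVec, wedge_mulVec, e, e, h0, h1, h2, h3]
    simp
  have hfix : ∀ μ : ℝ, M μ *ᵥ (p + μ • X 0) = p + μ • X 0 := fun μ => by
    have := mulVec_of_hasDerivAt hEskew (hA μ) (hA0 μ) (hv μ) T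
    rw [← zero_add T, hcurve.periodic, zero_add] at this
    exact this
  have hneg : ∀ μ : ℝ, -κ / 2 < μ → ip (p + μ • X 0) (p + μ • X 0) < 0 := fun μ hμ => by
    have h0 : ip (X 0) (X 0) = 0 := (hcurve.mem 0).1
    have h1 : ip (X 0) p = -1 := (hcurve.mem 0).2
    have : ip (p + μ • X 0) (p + μ • X 0) = ip p p + 2 * μ * ip (X 0) p + μ ^ 2 * ip (X 0) (X 0) := by
      simp only [ip_eq, Pi.add_apply, Pi.smul_apply, smul_eq_mul]
      ring
    rw [this, h0, h1, hp]
    linarith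
  have hres : ∀ μ : ℝ, μ ≠ 0 → ∀ l : ℕ, M μ ^ l = 1 → Λ.IsResonancePoint (l * T) μ := by
    intro μ hμ l hl
    refine ⟨hμ, 1, ⟨X, hX, LinearODE.solution E μ, hA0 μ, fun s i j => ?_, ?_⟩,
      isDiagonalisable_one, ?_⟩
    · have := (LinearMap.toContinuousLinearMap
        (Matrix.entryLinearMap ℝ ℝ i j)).hasFDerivAt.comp_hasDerivAt s (hA μ s)
      refine this.congr_deriv ?_
      simp [heta]
      rfl
    · rw [apply_nat_mul_period hEskew (hA μ) (hA0 μ) hEper, hl]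
    · rw [Matrix.charpoly_one]
      simp
  have hana : AnalyticOnNhd ℝ (fun μ => (M μ).trace) Set.univ :=
    LinearODE.analyticOnNhd_solution hC
      (LinearMap.toContinuousLinearMap (Matrix.traceLinearMap (Fin 4) ℝ ℝ)) T
  have hcont : Continuous fun μ => (M μ).trace - 2 :=
    (continuousOn_univ.1 hana.continuousOn).sub continuous_const
  -- A connected set of parameters on which `μ ≠ 0` and the fixed vector is timelike.
  set J : Set ℝ := Set.Ioi (max (-κ / 2) 0) with hJ
  have hJ1 : ∀ μ ∈ J, -κ / 2 < μ := fun μ hμ => (le_max_left _ _).trans_lt hμ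
  have hJ2 : ∀ μ ∈ J, μ ≠ 0 := fun μ hμ => ((le_max_right _ _).trans_lt hμ).ne'
  have hbound : ∀ μ ∈ J, |(M μ).trace - 2| ≤ 2 := fun μ hμ =>
    abs_trace_sub_two_le (hiso μ) (hdet μ) (hneg μ (hJ1 μ hμ)) (hfix μ)
  by_cases hconst : ∀ a ∈ J, ∀ b ∈ J, (M a).trace - 2 ≤ (M b).trace - 2
  · obtain ⟨μ, hμ⟩ : J.Nonempty := Set.nonempty_Ioi
    have hev : (fun ν => (M ν).trace) =ᶠ[𝓝 μ] fun _ => (M μ).trace := by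
      filter_upwards [isOpen_Ioi.mem_nhds hμ] with ν hν
      linarith [hconst μ hμ ν hν, hconst ν hν μ hμ]
    -- The point `0` lies outside `J`, and for `κ < 0` even outside its closure, so analyticity, not
    -- just continuity, is needed to carry the value `4` over.
    have heq := congrFun (hana.eq_of_eventuallyEq analyticOnNhd_const hev) 0
    have htr : (M μ).trace = 4 := by
      rw [← heq]
      simp [hMdef, LinearODE.solution_zero_left]
    refine ⟨μ, hJ1 μ hμ, 1, le_rfl, hres μ (hJ2 μ hμ) 1 ?_⟩
    rw [pow_one]
    exact eq_one_of_trace_eq (hiso μ) (hdet μ) (hneg μ (hJ1 μ hμ)) (hfix μ) htr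
  · push Not at hconst
    obtain ⟨a, ha, b, hb, hab⟩ := hconst
    obtain ⟨μ, hμ, m, l, hl, hc, hlt⟩ := exists_rational_angle_of_ne hcont
      isPreconnected_Ioi hbound hb ha hab
    exact ⟨μ, hJ1 μ hμ, l, hl, hres μ (hJ2 μ hμ) l (pow_eq_one_of_trace_eq
      (mul_eq_zero_of_isometry (hiso μ) (hdet μ) (hneg μ (hJ1 μ hμ)) (hfix μ)) hl hc hlt)⟩

end LightconeModel

end

theorem corollary4p3 (Λ : LightconeModel.PolarisedCurve) (T : ℝ) (hT : 0 < T)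
    (hclosed : Λ.IsClosedWithPeriod T) (hfinite : Λ.IsFiniteType T)
    (κ : ℝ) (p : LightconeModel.V) (hp : LightconeModel.ip p p = -κ)
    (X : ℝ → LightconeModel.V) (hX : LightconeModel.IsLift Λ.L X)
    (helastic : LightconeModel.IsConstrainedElastic p T X)
    (harc : ∀ s, Λ.q s = LightconeModel.ip (deriv X s) (deriv X s)) :
    ∃ μ : ℝ, -κ / 2 < μ ∧ ∃ ℓ : ℕ, 1 ≤ ℓ ∧ Λ.IsResonancePoint (ℓ * T) μ :=
  LightconeModel.exists_resonancePoint_of_arcLength Λ T κ p hp X hX helastic.1 harc hT
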